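/- All graphs are finite, simple and connected. An edge-colouring of a graph $\Gamma$ with $k$ colours (adjacent edges may receive the same colour) is a (strong) rainbow $k$-colouring if any two distinct vertices $u,v$ are joined by a path all of whose edges have distinct colours (and whose length, in the strong case, equals the distance $d(u,v)$). The (strong) rainbow connection number $\mathrm{rc}(\Gamma)$ (respectively $\mathrm{src}(\Gamma)$) is the least $k$ for which a (strong) rainbow $k$-colouring of $\Gamma$ exists. Let $C_n$ be the cycle with $n$ vertices for $n\ge 3$, and let $C_2$ be a single edge. **Theorem.** Let $n_1,\dots,n_r\ge 2$ be integers, let $\mu$ be the number of even numbers among them, and let $M=C_{n_1}\square\cdots\square C_{n_r}$ be the toroidal mesh (Cartesian product of graphs). Then $$\mathrm{src}(M)\le B:=\begin{cases}\left\lceil\dfrac{n_1+\cdots+n_r-\mu}{2}\right\rceil, & 0\le\mu\le\lfloor r/2\rfloor,\\[2ex] \left\lceil\dfrac{n_1+\cdots+n_r-r+\mu}{2}\right\rceil, & \lfloor r/2\rfloor+1\le\mu\le r.\end{cases}$$ This improves the upper bound $\sum_{k=1}^r\lceil n_k/2\rceil$ of Li et al.: one always has $B\le\sum_{k=1}^r\lceil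 n_k/2\rceil$, with strict inequality if $r\ge2$ and some $n_k$ is odd. It also gives a negative answer to the following question of Li et al.: if $G$ is a finite abelian group, $S\subseteq G\setminus\{1\}$ is a generating set that is minimal among the inverse-closed generating sets, and $S^*\subseteq S$ is a minimal generating set of $G$, does the Cayley graph $C(G,S)$ always satisfy $\mathrm{src}(C(G,S))=\mathrm{rc}(C(G,S))=\sum_{a\in S^*}\lceil |a|/2\rceil$, where $|a|$ is the order of $a$? Namely, whenever $r\ge2$ and some $n_k$ is odd, there are such $G,S,S^*$ for which $C(G,S)$ is isomorphic to $M$ and these equalities do not both hold. -/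

import Mathlib

namespace RainbowConnection

/-- A walk `p` is a rainbow path under the edge colouring `c`: it is a path, and distinct edges of
`p` have distinct colours. -/
def IsRainbowPath {V K : Type*} {G : SimpleGraph V} (c : G.EdgeLabeling K) {u v : V}
    (p : G.Walk u v) : Prop :=
  p.IsPath ∧ Set.InjOn c {e : G.edgeSet | (e : Sym2 V) ∈ p.edges}

/-- Any two distinct vertices are joined by a rainbow path. -/
def IsRainbowColoring {V K : Type*} (G : SimpleGraph V) (c : G.EdgeLabeling K) : Prop :=
  ∀ u v : V, u ≠ v → ∃ p : G.Walk u v, IsRainbowPath c p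

/-- Any two distinct vertices `u`, `v` are joined by a rainbow path of length `d(u, v)`. -/
def IsStrongRainbowColoring {V K : Type*} (G : SimpleGraph V) (c : G.EdgeLabeling K) : Prop :=
  ∀ u v : V, u ≠ v → ∃ p : G.Walk u v, IsRainbowPath c p ∧ p.length = G.dist u v

/-- The rainbow connection number: the least `k` for which a rainbow colouring with `k` colours
exists (`⊤` if there is none, which does not happen for finite connected graphs). -/
noncomputable def rc {V : Type*} (G : SimpleGraph V) : ℕ∞ :=
  ⨅ k ∈ {k : ℕ | ∃ c : G.EdgeLabeling (Fin k), IsRainbowColoring G c}, (k : ℕ∞)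

/-- The strong rainbow connection number: the least `k` for which a strong rainbow colouring with
`k` colours exists (`⊤` if there is none, which does not happen for finite connected graphs). -/
noncomputable def src {V : Type*} (G : SimpleGraph V) : ℕ∞ :=
  ⨅ k ∈ {k : ℕ | ∃ c : G.EdgeLabeling (Fin k), IsStrongRainbowColoring G c}, (k : ℕ∞)

/-- The Cartesian (box) product of a family of graphs: two vertices are adjacent if they are
adjacent in one coordinate and agree in all the others. -/
def cartesianProduct {ι : Type*} {V : ι → Type*} (G : ∀ i, SimpleGraph (V i)) :
    SimpleGraph (∀ i, V i) where
  Adj x y := ∃ i, (G i).Adj (x i) (y i) ∧ ∀ j, j ≠ i → x j = y j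
  symm := ⟨fun _ _ ⟨i, h, h'⟩ => ⟨i, h.symm, fun j hj => (h' j hj).symm⟩⟩
  loopless := ⟨fun _ ⟨_, h, _⟩ => h.ne rfl⟩

/-- The toroidal mesh `C_{n_1} □ ⋯ □ C_{n_r}`; here `C_2` is a single edge. -/
def toroidalMesh {r : ℕ} (n : Fin r → ℕ) : SimpleGraph (∀ k, Fin (n k)) :=
  cartesianProduct fun k => SimpleGraph.cycleGraph (n k)

/-- The number `μ` of even numbers among `n_1, …, n_r`. -/
def evenCount {r : ℕ} (n : Fin r → ℕ) : ℕ :=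
  (Finset.univ.filter fun k => Even (n k)).card

/-- `S` is a generating set of the abelian group `A`, and no proper subset of `S` generates `A`. -/
def IsMinimalGenerating {A : Type*} [AddCommGroup A] (S : Set A) : Prop :=
  AddSubgroup.closure S = ⊤ ∧ ∀ T : Set A, T ⊂ S → AddSubgroup.closure T ≠ ⊤

/-- `S` is a generating set of the (additively written) abelian group `A` that does not contain
the identity, is closed under inverses, and is minimal among the inverse-closed generating sets. -/
def IsInverseClosedMinimalGenerating {A : Type*} [AddCommGroup A] (S : Set A) : Prop :=
  (0 : A) ∉ S ∧ (∀ a ∈ S, -a ∈ S) ∧ AddSubgroup.closure S = ⊤ ∧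
    ∀ T : Set A, T ⊂ S → (∀ a ∈ T, -a ∈ T) → AddSubgroup.closure T ≠ ⊤

/-- The upper bound for `src (C_{n_1} □ ⋯ □ C_{n_r})`; `r / 2` is `⌊r / 2⌋`. Both numerators
are nonnegative when all `n_k ≥ 1`. -/
def meshBound {r : ℕ} (n : Fin r → ℕ) : ℕ :=
  if evenCount n ≤ r / 2 then
    ⌈((∑ k, (n k : ℚ)) - (evenCount n : ℚ)) / 2⌉₊
  else
    ⌈((∑ k, (n k : ℚ)) - (r : ℚ) + (evenCount n : ℚ)) / 2⌉₊

end RainbowConnection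

namespace RainbowConnection

open SimpleGraph

/-! The proof gives more than the stated bound: ∑ ⌊n_k/2⌋ colours suffice if some n_k is even, and
one extra colour suffices otherwise. The cycle C_{2m} needs only m colours, repeated periodically,
because a geodesic uses at most m cyclically consecutive edges. Multiplying a graph by C_{2m}
therefore costs m colours, with disjoint palettes. An odd cycle C_{2m+1} would need m + 1 colours on
its own. As a factor of G □ C_{2m+1} it costs only m: its last edge borrows a colour s of G. A
geodesic that crosses this edge can be routed to do its G-part over a cycle vertex y < m, where s
has been exchanged for a cycle colour that the geodesic does not use
(`StronglyRainbowColorable.boxProd_cycleGraph_odd`). The borrowing needs G to have a colour, so the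
induction over the factors starts from an even cycle if there is one, and otherwise from a single
vertex with one dummy colour. In the counterexample the group is a product of cyclic groups and the
generators are the standard ones and their inverses. The sum over orders is then ∑ ⌈n_k/2⌉, which
exceeds the bound. -/

/-- Under the colouring `c` of pairs of vertices, some geodesic from `u` to `v` is rainbow. -/
def HasRainbowGeodesic {V K : Type*} (G : SimpleGraph V) (c : Sym2 V → K) (u v : V) : Prop :=
  ∃ p : G.Walk u v, (p.edges.map c).Nodup ∧ p.length = G.dist u v

/-- `G` has a colouring with `k` colours under which all pairs of vertices are joined by rainbow
geodesics; the colours are given on all pairs of vertices, adjacent or not. -/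
def StronglyRainbowColorable {V : Type*} (G : SimpleGraph V) (k : ℕ) : Prop :=
  ∃ c : Sym2 V → Fin k, ∀ u v, HasRainbowGeodesic G c u v

/-! ### Rainbow geodesics and changes of palette or graph -/

variable {V W K L : Type*} {G : SimpleGraph V} {H : SimpleGraph W}

theorem HasRainbowGeodesic.symm {c : Sym2 V → K} {u v : V} (h : HasRainbowGeodesic G c u v) :
    HasRainbowGeodesic G c v u := by
  obtain ⟨p, hp, hl⟩ := h
  exact ⟨p.reverse, by simpa using hp, by rw [Walk.length_reverse, hl, dist_comm]⟩

theorem HasRainbowGeodesic.comp_injective {c : Sym2 V → K} {u v : V} {f : K → L}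
    (h : HasRainbowGeodesic G c u v) (hf : f.Injective) : HasRainbowGeodesic G (f ∘ c) u v := by
  obtain ⟨p, hp, hl⟩ := h
  exact ⟨p, by rw [← List.map_map]; exact hp.map hf, hl⟩

theorem StronglyRainbowColorable.of_card [Fintype K] {c : Sym2 V → K}
    (hc : ∀ u v, HasRainbowGeodesic G c u v) {k : ℕ} (hk : Fintype.card K ≤ k) :
    StronglyRainbowColorable G k :=
  ⟨(Fin.castLE hk ∘ Fintype.equivFin K) ∘ c, fun u v => (hc u v).comp_injective
    ((Fin.castLE_injective hk).comp (Fintype.equivFin K).injective)⟩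

theorem StronglyRainbowColorable.mono {k l : ℕ} (h : StronglyRainbowColorable G k) (hkl : k ≤ l) :
    StronglyRainbowColorable G l := by
  obtain ⟨c, hc⟩ := h
  exact .of_card hc (by simpa using hkl)

theorem StronglyRainbowColorable.of_iso {k : ℕ} (h : StronglyRainbowColorable G k) (e : G ≃g H) :
    StronglyRainbowColorable H k := by
  obtain ⟨c, hc⟩ := h
  refine ⟨c ∘ Sym2.map e.symm, fun u v => ?_⟩
  obtain ⟨p, hp, hl⟩ := hc (e.symm u) (e.symm v)
  have hmap : ∀ l : List (Sym2 V), (l.map (Sym2.map e)).map (c ∘ Sym2.map e.symm) = l.map c := by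
    intro l
    rw [List.map_map]
    refine List.map_congr_left fun x _ => ?_
    induction x with | _ a b => simp
  refine ⟨(p.map e.toHom).copy (by simp) (by simp), ?_, ?_⟩
  · rw [Walk.edges_copy, Walk.edges_map]
    exact (hmap _).symm ▸ hp
  · rw [Walk.length_copy, Walk.length_map, hl]
    refine le_antisymm ?_ ?_
    · have hr : H.Reachable u v := by
        simpa using (p.map e.toHom).reachable
      obtain ⟨q, hq⟩ := hr.exists_walk_length_eq_dist
      rw [← hq, ← Walk.length_map e.symm.toHom q]
      exact dist_le _
    · rw [← hl, ← Walk.length_map e.toHom p]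
      have := dist_le (p.map e.toHom)
      simpa using this

/-- A walk of length equal to the distance is automatically a path, so `HasRainbowGeodesic` need not
require it. -/
theorem StronglyRainbowColorable.src_le {k : ℕ} (h : StronglyRainbowColorable G k) :
    src G ≤ k := by
  obtain ⟨c, hc⟩ := h
  refine iInf₂_le k ⟨fun e => c e, fun u v _ => ?_⟩
  obtain ⟨p, hp, hl⟩ := hc u v
  refine ⟨p, ⟨p.isPath_of_length_eq_dist hl, fun e he f hf hef => Subtype.ext ?_⟩, hl⟩
  exact List.inj_on_of_nodup_map hp he hf hef

/-! ### Box products -/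

/-- The colouring of pairs in `V × W` that colours pairs within the copy of `V` over `b` by `cV b`,
and the other pairs by `cW`, according to their second components. -/
noncomputable def boxProdColoring (cV : W → Sym2 V → K) (cW : Sym2 W → K) : Sym2 (V × W) → K :=
  open Classical in
  Sym2.lift ⟨fun x y => if x.2 = y.2 then cV x.2 s(x.1, y.1) else cW s(x.2, y.2), fun x y => by
    by_cases h : x.2 = y.2
    · simp [h, Sym2.eq_swap]
    · simp [h, Ne.symm h, Sym2.eq_swap]⟩

theorem dist_boxProd {x y : V × W} (hG : G.Reachable x.1 y.1) (hH : H.Reachable x.2 y.2) :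
    (G □ H).dist x y = G.dist x.1 y.1 + H.dist x.2 y.2 := by
  rw [SimpleGraph.dist, edist_boxProd, ENat.toNat_add (edist_ne_top_iff_reachable.2 hG)
    (edist_ne_top_iff_reachable.2 hH)]
  rfl

/-- Distances add in a box product, so walking first along `q` and then along `p` is a geodesic. In
this order the whole `V`-part lies over the endpoint `y'`, and only the colouring `cV y'` matters.
-/
theorem hasRainbowGeodesic_boxProd (cV : W → Sym2 V → K) (cW : Sym2 W → K) {u u' : V} {y y' : W}
    (q : H.Walk y y') (hq : q.length = H.dist y y') (p : G.Walk u u')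
    (hp : p.length = G.dist u u')
    (hqp : (q.edges.map cW ++ p.edges.map (cV y')).Nodup) :
    HasRainbowGeodesic (G □ H) (boxProdColoring cV cW) (u, y) (u', y') := by
  have hq' : (q.boxProdRight G u).edges = q.edges.map (Sym2.map fun b => (u, b)) :=
    Walk.edges_map _ q
  have hp' : (p.boxProdLeft H y').edges = p.edges.map (Sym2.map fun a => (a, y')) :=
    Walk.edges_map _ p
  have hql : (q.boxProdRight G u).length = q.length := Walk.length_map _ q
  have hpl : (p.boxProdLeft H y').length = p.length := Walk.length_map _ p
  refine ⟨(q.boxProdRight G u).append (p.boxProdLeft H y'), ?_, ?_⟩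
  · rw [Walk.edges_append, List.map_append, hq', hp', List.map_map, List.map_map]
    convert hqp using 2
    · refine List.map_congr_left fun e he => ?_
      have hn := H.not_isDiag_of_mem_edgeSet (q.edges_subset_edgeSet he)
      induction e with
      | _ a b => simp_all [boxProdColoring]
    · refine List.map_congr_left fun e _ => ?_
      induction e with
      | _ a b => simp [boxProdColoring]
  · rw [dist_boxProd p.reachable q.reachable, Walk.length_append, hql, hpl, hp, hq, add_comm]

theorem StronglyRainbowColorable.boxProd {k l : ℕ} (hG : StronglyRainbowColorable G k)
    (hH : StronglyRainbowColorable H l) : StronglyRainbowColorable (G □ H) (k + l) := by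
  obtain ⟨c, hc⟩ := hG
  obtain ⟨d, hd⟩ := hH
  refine .of_card (K := Fin k ⊕ Fin l)
    (c := boxProdColoring (fun _ => Sum.inl ∘ c) (Sum.inr ∘ d)) ?_ (by simp)
  rintro ⟨u, y⟩ ⟨u', y'⟩
  obtain ⟨p, hp, hpl⟩ := hc u u'
  obtain ⟨q, hq, hql⟩ := hd y y'
  refine hasRainbowGeodesic_boxProd _ _ q hql p hpl ?_
  rw [← List.map_map, ← List.map_map]
  refine (hq.map Sum.inr_injective).append (hp.map Sum.inl_injective) ?_
  simp [List.disjoint_left]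

/-! ### Distances and colourings in cycles -/

/-- The edge `{i, i + 1}` of the cycle with vertices `0, …, n - 1` gets colour `g i`, and the edge
`{n - 1, 0}` gets colour `g (n - 1)`. -/
def cycleColoring (n : ℕ) (g : ℕ → K) : Sym2 (Fin n) → K :=
  Sym2.lift ⟨fun a b => if a.val + 1 = b.val ∨ b.val + 1 = a.val then g (min a.val b.val)
    else g (n - 1), fun a b => by simp only [or_comm, min_comm]⟩

theorem cycleGraph_adj_val {n : ℕ} {a b : Fin n} (h : (cycleGraph n).Adj a b) :
    a.val + 1 = b.val ∨ b.val + 1 = a.val ∨ (a.val = 0 ∧ b.val + 1 = n) ∨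
      (b.val = 0 ∧ a.val + 1 = n) := by
  rw [cycleGraph_adj'] at h
  have ha := a.isLt
  have hb := b.isLt
  rcases h with h | h
  · rcases le_or_gt b a with hle | hlt
    · rw [Fin.sub_val_of_le hle] at h
      omega
    · rw [Fin.coe_sub_iff_lt.2 hlt] at h
      omega
  · rcases le_or_gt a b with hle | hlt
    · rw [Fin.sub_val_of_le hle] at h
      omega
    · rw [Fin.coe_sub_iff_lt.2 hlt] at h
      omega

theorem cycleGraph_adj_of_val {n : ℕ} (hn : 2 ≤ n) {a b : Fin n}
    (h : a.val + 1 = b.val ∨ (b.val = 0 ∧ a.val + 1 = n)) : (cycleGraph n).Adj a b := by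
  rw [cycleGraph_adj']
  have ha := a.isLt
  have hb := b.isLt
  right
  rcases h with h | h
  · rw [Fin.sub_val_of_le (Fin.le_def.2 (by omega))]
    omega
  · rw [Fin.coe_sub_iff_lt.2 (Fin.lt_def.2 (by omega))]
    omega

/-- One step along the cycle changes the cyclic distance to `b` by at most 1. -/
theorem cycleGraph_walk_length {n : ℕ} {a b : Fin n} (p : (cycleGraph n).Walk a b) :
    min (max a.val b.val - min a.val b.val) (n - (max a.val b.val - min a.val b.val)) ≤
      p.length := by
  induction p with
  | nil => simp
  | @cons u v w h p ih =>
    have := cycleGraph_adj_val h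
    have hu := u.isLt
    have hv := v.isLt
    have hw := w.isLt
    rw [Walk.length_cons]
    omega

theorem cycleGraph_walk_length_eq_dist {n : ℕ} {a b : Fin n} (p : (cycleGraph n).Walk a b)
    (h : p.length = min (max a.val b.val - min a.val b.val)
      (n - (max a.val b.val - min a.val b.val))) :
    p.length = (cycleGraph n).dist a b := by
  refine le_antisymm ?_ (dist_le p)
  obtain ⟨q, hq⟩ := p.reachable.exists_walk_length_eq_dist
  rw [← hq, h]
  exact cycleGraph_walk_length q

theorem exists_cycleGraph_walk {n : ℕ} (hn : 2 ≤ n) (g : ℕ → K) (d : ℕ) :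
    ∀ a b : Fin n, a.val + d = b.val → ∃ p : (cycleGraph n).Walk a b, p.length = d ∧
      p.edges.map (cycleColoring n g) = (List.range' a d).map g := by
  induction d with
  | zero =>
    intro a b h
    obtain rfl : a = b := Fin.ext h
    exact ⟨.nil, rfl, by simp⟩
  | succ d ih =>
    intro a b h
    have hb := b.isLt
    obtain ⟨p, hp, hpe⟩ := ih ⟨a + 1, by omega⟩ b (by simp; omega)
    refine ⟨.cons (cycleGraph_adj_of_val hn (Or.inl rfl)) p, by simp [hp], ?_⟩
    rw [Walk.edges_cons, List.map_cons, hpe, List.range'_succ, List.map_cons]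
    simp [cycleColoring]

/-- The walk ascends to `n - 1`, crosses to `0` and ascends to `b`. For `n = 2` the closing edge
coincides with `{0, 1}` and has colour `g 0`, not `g 1`. -/
theorem exists_cycleGraph_walk_wrap {n : ℕ} (hn : 3 ≤ n) (g : ℕ → K) (a b : Fin n)
    (hba : b < a) : ∃ p : (cycleGraph n).Walk a b, p.length = n - (a - b) ∧
      p.edges.map (cycleColoring n g) =
        (List.range' a (n - a)).map g ++ (List.range' 0 b).map g := by
  have ha := a.isLt
  have hb : b.val < a.val := hba
  obtain ⟨p, hp, hpe⟩ := exists_cycleGraph_walk (by omega) g (n - 1 - a) a ⟨n - 1, by omega⟩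
    (by simp; omega)
  obtain ⟨q, hq, hqe⟩ := exists_cycleGraph_walk (by omega) g b ⟨0, by omega⟩ b (by simp)
  have hadj : (cycleGraph n).Adj ⟨n - 1, by omega⟩ ⟨0, by omega⟩ :=
    cycleGraph_adj_of_val (by omega) (Or.inr ⟨rfl, by simp; omega⟩)
  refine ⟨p.append (.cons hadj q), by simp [hp, hq]; omega, ?_⟩
  rw [Walk.edges_append, List.map_append, Walk.edges_cons, List.map_cons, hpe, hqe,
    show n - a = n - 1 - a + 1 by omega, List.range'_concat, List.map_append, List.append_assoc]
  have h1 : ¬ (n - 1 + 1 = 0 ∨ 0 + 1 = n - 1) := by omega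
  have h2 : a.val + (n - 1 - a) = n - 1 := by omega
  simp [cycleColoring, h2]
  omega

theorem eq_of_mod_eq_of_window {m x y : ℕ} (h : x % m = y % m) (hxy : x < y + m)
    (hyx : y < x + m) : x = y := by
  have h1 := Nat.div_add_mod x m
  have h2 := Nat.div_add_mod y m
  rcases lt_trichotomy (x / m) (y / m) with hlt | heq | hlt
  · have := Nat.mul_le_mul_left m hlt
    rw [Nat.succ_eq_add_one, mul_add] at this
    omega
  · rw [heq] at h1
    omega
  · have := Nat.mul_le_mul_left m hlt
    rw [Nat.succ_eq_add_one, mul_add] at this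
    omega

theorem mod_of_lt_two_mul {m x : ℕ} (h : x < 2 * m) :
    (x < m ∧ x % m = x) ∨ (m ≤ x ∧ x % m = x - m) := by
  rcases lt_or_ge x m with h' | h'
  · exact Or.inl ⟨h', Nat.mod_eq_of_lt h'⟩
  · exact Or.inr ⟨h', by rw [Nat.mod_eq_sub_mod h', Nat.mod_eq_of_lt (by omega)]⟩

theorem stronglyRainbowColorable_cycleGraph_even {m : ℕ} (hm : 1 ≤ m) :
    StronglyRainbowColorable (cycleGraph (2 * m)) m := by
  have hmod : ∀ i, i % m < m := fun i => Nat.mod_lt _ hm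
  refine ⟨cycleColoring (2 * m) fun i => ⟨i % m, hmod i⟩, ?_⟩
  have key : ∀ a b : Fin (2 * m), a ≤ b →
      HasRainbowGeodesic (cycleGraph (2 * m))
        (cycleColoring (2 * m) fun i => (⟨i % m, hmod i⟩ : Fin m)) a b := by
    intro a b hab
    have hb := b.isLt
    have hab' : a.val ≤ b.val := hab
    rcases le_or_gt (b.val - a.val) m with hd | hd
    · obtain ⟨p, hp, hpe⟩ := exists_cycleGraph_walk (by omega)
        (fun i => (⟨i % m, hmod i⟩ : Fin m)) (b.val - a.val) a b (by omega)
      refine ⟨p, ?_, cycleGraph_walk_length_eq_dist p (by omega)⟩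
      rw [hpe]
      refine List.Nodup.map_on ?_ List.nodup_range'
      intro x hx y hy hxy
      rw [List.mem_range'_1] at hx hy
      exact eq_of_mod_eq_of_window (Fin.mk.inj hxy) (by omega) (by omega)
    · obtain ⟨p, hp, hpe⟩ := exists_cycleGraph_walk_wrap (by omega)
        (fun i => (⟨i % m, hmod i⟩ : Fin m)) b a (Fin.lt_def.2 (by omega))
      refine HasRainbowGeodesic.symm ⟨p, ?_, cycleGraph_walk_length_eq_dist p (by omega)⟩
      rw [hpe, ← List.map_append]
      -- Modulo `m`, the edges from `b` on have colours `b - m, …, m - 1`, and those before `a` have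
      -- colours `0, …, a - 1`. These are disjoint because `a < b - m`.
      refine List.Nodup.map_on ?_ (List.Nodup.append List.nodup_range' List.nodup_range' ?_)
      · intro x hx y hy hxy
        rw [List.mem_append, List.mem_range'_1, List.mem_range'_1] at hx hy
        have := Fin.mk.inj hxy
        have := mod_of_lt_two_mul (show x < 2 * m by omega)
        have := mod_of_lt_two_mul (show y < 2 * m by omega)
        omega
      · intro x hx hy
        rw [List.mem_range'_1] at hx hy
        omega
  intro a b
  rcases le_total a b with h | h
  · exact key a b h
  · exact (key b a h).symm

/-! ### Multiplying by a cycle -/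

/-- If `G` has a strong rainbow colouring with a nonempty set of colours, then multiplying `G` by
the odd cycle `C_{2m+1}` costs only `m` further colours. One fixed colour `s` of `G` is used for the
edge `{2m, 0}` of the cycle; in the copies of `G` over the vertices `y < m` of the cycle, it is
replaced by the colour of the edge `{y, y + 1}`. -/
theorem StronglyRainbowColorable.boxProd_cycleGraph_odd {k m : ℕ} (hk : 1 ≤ k) (hm : 1 ≤ m)
    (hG : StronglyRainbowColorable G k) :
    StronglyRainbowColorable (G □ cycleGraph (2 * m + 1)) (k + m) := by
  obtain ⟨c, hc⟩ := hG
  let s : Fin k := ⟨0, hk⟩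
  have hmod : ∀ i, i % m < m := fun i => Nat.mod_lt _ hm
  let f : Fin (2 * m + 1) → Fin k → Fin k ⊕ Fin m := fun y x =>
    if h : y.val < m ∧ x = s then Sum.inr ⟨y, h.1⟩ else Sum.inl x
  let g : ℕ → Fin k ⊕ Fin m := fun i => if i < 2 * m then Sum.inr ⟨i % m, hmod i⟩ else Sum.inl s
  have hf : ∀ y, (f y).Injective := by
    intro y x x' h
    simp only [f] at h
    split_ifs at h with h1 h2 h2
    · rw [h1.2, h2.2]
    · exact Sum.inl_injective h
  refine .of_card (K := Fin k ⊕ Fin m)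
    (c := boxProdColoring (fun y => f y ∘ c) (cycleColoring (2 * m + 1) g)) ?_ (by simp)
  have key : ∀ u u' (a b : Fin (2 * m + 1)), a ≤ b →
      HasRainbowGeodesic (G □ cycleGraph (2 * m + 1))
        (boxProdColoring (fun y => f y ∘ c) (cycleColoring (2 * m + 1) g)) (u, a) (u', b) := by
    intro u u' a b hab
    have hb := b.isLt
    have hab' : a.val ≤ b.val := hab
    rcases le_or_gt (b.val - a.val) m with hd | hd
    · obtain ⟨p, hp, hpl⟩ := hc u u'
      obtain ⟨q, hq, hqe⟩ := exists_cycleGraph_walk (by omega) g (b.val - a.val) a b (by omega)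
      refine hasRainbowGeodesic_boxProd _ _ q (cycleGraph_walk_length_eq_dist q (by omega)) p hpl ?_
      have hr : ∀ x ∈ List.range' a.val (b.val - a.val), g x = Sum.inr ⟨x % m, hmod x⟩ := by
        intro x hx
        rw [List.mem_range'_1] at hx
        exact if_pos (by omega)
      rw [hqe, ← List.map_map]
      refine List.Nodup.append (List.Nodup.map_on ?_ List.nodup_range') (hp.map (hf b)) ?_
      · intro x hx y hy hxy
        rw [hr x hx, hr y hy] at hxy
        rw [List.mem_range'_1] at hx hy
        exact eq_of_mod_eq_of_window (Fin.mk.inj (Sum.inr_injective hxy)) (by omega) (by omega)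
      -- The only possible clash is with the cycle colour `b`, which occurs over `b` only if `b <
      -- m`. In that case the cycle edges `a, …, b - 1` have their own indices as colours, all below
      -- `b`.
      · intro z hz hz'
        obtain ⟨x, hx, rfl⟩ := List.mem_map.1 hz
        obtain ⟨y, -, hy⟩ := List.mem_map.1 hz'
        rw [hr x hx] at hy
        rw [List.mem_range'_1] at hx
        simp only [f] at hy
        split_ifs at hy with h
        have := Fin.mk.inj (Sum.inr_injective hy)
        rw [Nat.mod_eq_of_lt (by omega)] at this
        omega
    -- Here `a < m < b`. The geodesic is traversed from `b` to `a`, so that its `G`-part lies over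
    -- `a`, where `s` is replaced.
    · obtain ⟨p, hp, hpl⟩ := hc u' u
      obtain ⟨q, hq, hqe⟩ := exists_cycleGraph_walk_wrap (by omega) g b a
        (Fin.lt_def.2 (by omega))
      refine HasRainbowGeodesic.symm <|
        hasRainbowGeodesic_boxProd _ _ q (cycleGraph_walk_length_eq_dist q (by omega)) p hpl ?_
      have hr : ∀ x, x < 2 * m → g x = Sum.inr ⟨x % m, hmod x⟩ := fun x hx => if_pos hx
      have hr' : g (2 * m) = Sum.inl s := if_neg (lt_irrefl _)
      rw [hqe, ← List.map_map, ← List.map_append]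
      have hmem : ∀ x, x ∈ List.range' b.val (2 * m + 1 - b.val) ++ List.range' 0 a.val →
          (b.val ≤ x ∧ x < 2 * m) ∨ x = 2 * m ∨ x < a.val := by
        intro x hx
        rw [List.mem_append, List.mem_range'_1, List.mem_range'_1] at hx
        omega
      refine List.Nodup.append (List.Nodup.map_on ?_
        (List.Nodup.append List.nodup_range' List.nodup_range' ?_)) (hp.map (hf a)) ?_
      · intro x hx y hy hxy
        by_cases hx2 : x = 2 * m <;> by_cases hy2 : y = 2 * m
        · omega
        · rw [hx2, hr', hr y (by have := hmem y hy; omega)] at hxy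
          cases hxy
        · rw [hy2, hr', hr x (by have := hmem x hx; omega)] at hxy
          cases hxy
        · have hx := hmem x hx
          have hy := hmem y hy
          rw [hr x (by omega), hr y (by omega)] at hxy
          have := Fin.mk.inj (Sum.inr_injective hxy)
          have := mod_of_lt_two_mul (show x < 2 * m by omega)
          have := mod_of_lt_two_mul (show y < 2 * m by omega)
          omega
      · intro x hx hy
        rw [List.mem_range'_1] at hx hy
        omega
      -- The borrowed colour `s` does not occur over `a`. Its replacement `a` is not a colour of the
      -- cycle part, whose fresh colours are `b - m, …, m - 1` and `0, …, a - 1`, with `a < b - m`.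
      · intro z hz hz'
        obtain ⟨x, hx, rfl⟩ := List.mem_map.1 hz
        obtain ⟨y, -, hy⟩ := List.mem_map.1 hz'
        have hx := hmem x hx
        simp only [f] at hy
        by_cases hx2 : x = 2 * m
        · rw [hx2, hr'] at hy
          split_ifs at hy with h
          exact h ⟨by omega, Sum.inl_injective hy⟩
        · rw [hr x (by omega)] at hy
          split_ifs at hy with h
          have := Fin.mk.inj (Sum.inr_injective hy)
          have := mod_of_lt_two_mul (show x < 2 * m by omega)
          omega
  rintro ⟨u, a⟩ ⟨u', b⟩
  rcases le_total a b with h | h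
  · exact key u u' a b h
  · exact (key u' u b a h).symm

theorem StronglyRainbowColorable.boxProd_cycleGraph {k n : ℕ} (hk : 1 ≤ k) (hn : 2 ≤ n)
    (hG : StronglyRainbowColorable G k) :
    StronglyRainbowColorable (G □ cycleGraph n) (k + n / 2) := by
  rcases Nat.even_or_odd' n with ⟨m, rfl | rfl⟩
  · rw [Nat.mul_div_cancel_left m two_pos]
    exact hG.boxProd (stronglyRainbowColorable_cycleGraph_even (by omega))
  · rw [show (2 * m + 1) / 2 = m by omega]
    exact hG.boxProd_cycleGraph_odd hk (by omega)

/-! ### Induction over the factors of the mesh -/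

/-- The Cartesian product of a family indexed by `Fin (r + 1)`, with the factor `j` split off. -/
def cartesianProductSuccAbove {r : ℕ} {V : Fin (r + 1) → Type*} (G : ∀ i, SimpleGraph (V i))
    (j : Fin (r + 1)) :
    (G j).boxProd (cartesianProduct fun i => G (j.succAbove i)) ≃g cartesianProduct G where
  toEquiv := Fin.insertNthEquiv V j
  map_rel_iff' := by
    rintro ⟨a, x⟩ ⟨b, y⟩
    simp only [cartesianProduct, Fin.insertNthEquiv_apply, boxProd_adj, Fin.exists_iff_succAbove j,
      Fin.forall_iff_succAbove j, Fin.insertNth_apply_same, Fin.insertNth_apply_succAbove]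
    simp [funext_iff, Fin.ne_succAbove]
    exact or_congr Iff.rfl ⟨fun ⟨i, h, hab, h'⟩ => ⟨⟨i, h, h'⟩, hab⟩,
      fun ⟨⟨i, h, h'⟩, hab⟩ => ⟨i, h, hab, h'⟩⟩

/-- A graph times a graph with a single vertex. -/
def punitBoxProd (G : SimpleGraph V) : (⊥ : SimpleGraph Unit).boxProd G ≃g G where
  toEquiv := Equiv.punitProd V
  map_rel_iff' := by
    rintro ⟨a, x⟩ ⟨b, y⟩
    simp [boxProd_adj]

/-- The Cartesian product of a graph with an empty family of graphs. -/
def boxProdCartesianProductEmpty (G : SimpleGraph V) {ι : Type*} [IsEmpty ι] {W : ι → Type*}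
    (H : ∀ i, SimpleGraph (W i)) : G ≃g G.boxProd (cartesianProduct H) where
  toEquiv := (Equiv.prodUnique V (∀ i, W i)).symm
  map_rel_iff' := by
    intro a b
    simp [boxProd_adj, cartesianProduct]

/-- Replace the second factor of a box product by an isomorphic one. -/
def boxProdCongrRight (G : SimpleGraph V) {W' : Type*} {H' : SimpleGraph W'} (e : H ≃g H') :
    G.boxProd H ≃g G.boxProd H' where
  toEquiv := (Equiv.refl V).prodCongr e.toEquiv
  map_rel_iff' := by
    rintro ⟨a, x⟩ ⟨b, y⟩
    simp [boxProd_adj, e.map_adj_iff]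

/-- The graph `G` varies in the induction: each step absorbs one cycle into it, by associativity of
the box product. -/
theorem StronglyRainbowColorable.boxProd_toroidalMesh {r : ℕ} :
    ∀ {V : Type} {G : SimpleGraph V} {k : ℕ} (n : Fin r → ℕ), 1 ≤ k → (∀ i, 2 ≤ n i) →
      StronglyRainbowColorable G k →
        StronglyRainbowColorable (G □ toroidalMesh n) (k + ∑ i, n i / 2) := by
  induction r with
  | zero =>
    intro V G k n _ _ hG
    rw [Finset.univ_eq_empty, Finset.sum_empty, add_zero]
    exact hG.of_iso (boxProdCartesianProductEmpty G _)
  | succ r ih =>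
    intro V G k n hk hn hG
    have h := ih (fun i => n (Fin.succAbove 0 i)) (by omega) (fun i => hn _)
      (hG.boxProd_cycleGraph hk (hn 0))
    rw [Fin.sum_univ_succAbove _ 0, ← add_assoc]
    exact h.of_iso ((boxProdAssoc _ _ _).trans
      (boxProdCongrRight G (cartesianProductSuccAbove (fun i => cycleGraph (n i)) 0)))

/-- The 1 is a dummy colour on the one-vertex graph, there for the odd factors to borrow. -/
theorem stronglyRainbowColorable_toroidalMesh {r : ℕ} (n : Fin r → ℕ) (hn : ∀ i, 2 ≤ n i) :
    StronglyRainbowColorable (toroidalMesh n) (1 + ∑ i, n i / 2) := by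
  have h : StronglyRainbowColorable (⊥ : SimpleGraph Unit) 1 :=
    ⟨fun _ => 0, fun _ _ => ⟨.nil, by simp, by simp⟩⟩
  exact (h.boxProd_toroidalMesh n le_rfl hn).of_iso (punitBoxProd _)

/-- Starting from an even cycle, a colour to borrow is already present. -/
theorem stronglyRainbowColorable_toroidalMesh_of_even {r : ℕ} (n : Fin r → ℕ)
    (hn : ∀ i, 2 ≤ n i) (hev : ∃ j, Even (n j)) :
    StronglyRainbowColorable (toroidalMesh n) (∑ i, n i / 2) := by
  obtain ⟨j, hj⟩ := hev
  cases r with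
  | zero => exact j.elim0
  | succ r =>
    have hnj := hn j
    have hc : StronglyRainbowColorable (cycleGraph (n j)) (n j / 2) := by
      obtain ⟨m, hm⟩ := hj.exists_two_nsmul
      simp only [smul_eq_mul] at hm
      rw [hm, Nat.mul_div_cancel_left m two_pos]
      exact stronglyRainbowColorable_cycleGraph_even (by omega)
    rw [Fin.sum_univ_succAbove _ j]
    exact (hc.boxProd_toroidalMesh (fun i => n (j.succAbove i)) (by omega) fun i => hn _).of_iso
      (cartesianProductSuccAbove (fun i => cycleGraph (n i)) j)

/-! ### Arithmetic of the bounds -/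

theorem natCeil_natCast_div_two (a : ℕ) : ⌈(a : ℚ) / 2⌉₊ = (a + 1) / 2 := by
  refine eq_of_forall_ge_iff fun c => ?_
  rw [Nat.ceil_le, div_le_iff₀ two_pos]
  have : (a : ℚ) ≤ c * 2 ↔ a ≤ c * 2 := by exact_mod_cast Iff.rfl
  rw [this]
  omega

theorem evenCount_eq_sum {r : ℕ} (n : Fin r → ℕ) :
    evenCount n = ∑ i, if Even (n i) then 1 else 0 := by
  rw [evenCount, Finset.card_filter]

theorem sum_eq_two_mul_sum_div_two {r : ℕ} (n : Fin r → ℕ) :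
    ∑ i, n i + evenCount n = 2 * ∑ i, n i / 2 + r := by
  have hr : ∑ _i : Fin r, 1 = r := by simp
  have h : ∑ i, n i + evenCount n = 2 * ∑ i, n i / 2 + ∑ _i : Fin r, 1 := by
    rw [evenCount_eq_sum, Finset.mul_sum, ← Finset.sum_add_distrib, ← Finset.sum_add_distrib]
    refine Finset.sum_congr rfl fun i _ => ?_
    split_ifs with hi
    · obtain ⟨m, hm⟩ := hi
      omega
    · obtain ⟨m, hm⟩ := Nat.not_even_iff_odd.1 hi
      omega
  rwa [hr] at h

theorem evenCount_le {r : ℕ} (n : Fin r → ℕ) : evenCount n ≤ r :=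
  (Finset.card_filter_le _ _).trans (by simp)

theorem sum_natCeil_div_two {r : ℕ} (n : Fin r → ℕ) :
    ∑ k, ⌈(n k : ℚ) / 2⌉₊ + evenCount n = ∑ i, n i / 2 + r := by
  have hr : ∑ _i : Fin r, 1 = r := by simp
  have h : ∑ k, ⌈(n k : ℚ) / 2⌉₊ + evenCount n = ∑ i, n i / 2 + ∑ _i : Fin r, 1 := by
    rw [evenCount_eq_sum, ← Finset.sum_add_distrib, ← Finset.sum_add_distrib]
    refine Finset.sum_congr rfl fun i _ => ?_
    rw [natCeil_natCast_div_two]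
    split_ifs with hi
    · obtain ⟨m, hm⟩ := hi
      omega
    · obtain ⟨m, hm⟩ := Nat.not_even_iff_odd.1 hi
      omega
  rwa [hr] at h

theorem natCeil_sum_sub_evenCount {r : ℕ} (n : Fin r → ℕ) (h : evenCount n ≤ r / 2) :
    ⌈((∑ k, (n k : ℚ)) - (evenCount n : ℚ)) / 2⌉₊ =
      ∑ i, n i / 2 + (r - 2 * evenCount n + 1) / 2 := by
  have hs := sum_eq_two_mul_sum_div_two n
  have : (∑ k, (n k : ℚ)) - (evenCount n : ℚ) =
      ((2 * ∑ i, n i / 2 + (r - 2 * evenCount n) : ℕ) : ℚ) := by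
    rw [sub_eq_iff_eq_add]
    have : ∑ i, n i = 2 * ∑ i, n i / 2 + (r - 2 * evenCount n) + evenCount n := by omega
    exact_mod_cast this
  rw [this, natCeil_natCast_div_two]
  omega

theorem natCeil_sum_sub_add_evenCount {r : ℕ} (n : Fin r → ℕ) :
    ⌈((∑ k, (n k : ℚ)) - (r : ℚ) + (evenCount n : ℚ)) / 2⌉₊ = ∑ i, n i / 2 := by
  have hs := sum_eq_two_mul_sum_div_two n
  have : (∑ k, (n k : ℚ)) - (r : ℚ) + (evenCount n : ℚ) = ((2 * ∑ i, n i / 2 : ℕ) : ℚ) := by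
    rw [sub_add_eq_add_sub, sub_eq_iff_eq_add]
    exact_mod_cast hs
  rw [this, natCeil_natCast_div_two]
  omega

/-- Truncated subtraction merges the two cases: in the second, `2 * evenCount n` exceeds `r` and the
last term vanishes. -/
theorem meshBound_eq {r : ℕ} (n : Fin r → ℕ) :
    meshBound n = ∑ i, n i / 2 + (r - 2 * evenCount n + 1) / 2 := by
  rw [meshBound]
  split_ifs with h
  · exact natCeil_sum_sub_evenCount n h
  · rw [natCeil_sum_sub_add_evenCount]
    omega

theorem stronglyRainbowColorable_meshBound {r : ℕ} (hr : 1 ≤ r) (n : Fin r → ℕ)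
    (hn : ∀ i, 2 ≤ n i) : StronglyRainbowColorable (toroidalMesh n) (meshBound n) := by
  rw [meshBound_eq]
  by_cases hev : ∃ j, Even (n j)
  · exact (stronglyRainbowColorable_toroidalMesh_of_even n hn hev).mono (by omega)
  · have h0 : evenCount n = 0 := by
      rw [evenCount, Finset.card_eq_zero, Finset.filter_eq_empty_iff]
      exact fun i _ hi => hev ⟨i, hi⟩
    -- Without even factors the last term is `(r + 1) / 2`, which is at least 1 and pays for the
    -- dummy colour.
    exact (stronglyRainbowColorable_toroidalMesh n hn).mono (by omega)

theorem src_eq_zero_of_subsingleton {V : Type*} [Subsingleton V] (G : SimpleGraph V) :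
    src G = 0 := by
  refine nonpos_iff_eq_zero.1 (iInf₂_le 0 ⟨fun e => ?_, fun u v huv => ?_⟩)
  · exfalso
    obtain ⟨e, he⟩ := e
    induction e with
    | _ a b => exact he.ne (Subsingleton.elim a b)
  · exact absurd (Subsingleton.elim u v) huv

theorem src_toroidalMesh_le {r : ℕ} (n : Fin r → ℕ) (hn : ∀ i, 2 ≤ n i) :
    src (toroidalMesh n) ≤ meshBound n := by
  -- For `r = 0` the bound is 0, but `StronglyRainbowColorable` also colours diagonal pairs and so
  -- fails with no colours.
  rcases Nat.eq_zero_or_pos r with rfl | hr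
  · rw [src_eq_zero_of_subsingleton]
    exact zero_le
  · exact (stronglyRainbowColorable_meshBound hr n hn).src_le

theorem meshBound_le {r : ℕ} (n : Fin r → ℕ) : meshBound n ≤ ∑ k, ⌈(n k : ℚ) / 2⌉₊ := by
  have h := sum_natCeil_div_two n
  have h' := evenCount_le n
  rw [meshBound_eq]
  omega

/-- With μ even factors, the sum of ceilings exceeds ∑ ⌊n_k/2⌋ by r - μ, and the bound exceeds it by
⌈max(r - 2μ, 0)/2⌉. The latter is smaller when r ≥ 2 and μ < r. -/
theorem meshBound_lt {r : ℕ} (n : Fin r → ℕ) (hr : 2 ≤ r) (hodd : ∃ k, Odd (n k)) :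
    meshBound n < ∑ k, ⌈(n k : ℚ) / 2⌉₊ := by
  have h := sum_natCeil_div_two n
  have h' : evenCount n < r := by
    obtain ⟨k, hk⟩ := hodd
    have : evenCount n < (Finset.univ : Finset (Fin r)).card :=
      Finset.card_lt_card (Finset.filter_ssubset.2
        ⟨k, Finset.mem_univ k, Nat.not_even_iff_odd.2 hk⟩)
    simpa using this
  rw [meshBound_eq]
  omega

/-! ### The mesh as a Cayley graph -/

section Cayley

theorem Fin.val_nsmul_one {m : ℕ} [NeZero m] (j : ℕ) : (j • (1 : Fin m)).val = j % m := by
  induction j with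
  | zero => simp
  | succ j ih => rw [succ_nsmul, Fin.val_add, ih, Fin.val_one', ← Nat.add_mod]

theorem Fin.addOrderOf_one (m : ℕ) [NeZero m] : addOrderOf (1 : Fin m) = m := by
  have h : ∀ j : ℕ, addOrderOf (1 : Fin m) ∣ j ↔ m ∣ j := fun j => by
    rw [addOrderOf_dvd_iff_nsmul_eq_zero, Fin.ext_iff, Fin.val_nsmul_one, Fin.val_zero,
      Nat.dvd_iff_mod_eq_zero]
  exact Nat.dvd_antisymm ((h m).2 dvd_rfl) ((h _).1 dvd_rfl)

theorem Fin.val_eq_one_iff {m : ℕ} [NeZero m] (hm : 2 ≤ m) (x : Fin m) : x.val = 1 ↔ x = 1 := by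
  rw [Fin.ext_iff, Fin.val_one', Nat.mod_eq_of_lt hm]

theorem Fin.one_ne_zero_of_two_le {m : ℕ} [NeZero m] (hm : 2 ≤ m) : (1 : Fin m) ≠ 0 := by
  rw [Ne, Fin.ext_iff, Fin.val_one', Nat.mod_eq_of_lt hm]
  exact one_ne_zero

variable {r : ℕ} (n : Fin r → ℕ) [∀ k, NeZero (n k)]

/-- The standard generators of the product of the cyclic groups of orders `n k`. -/
def cyclicGenerator (k : Fin r) : ∀ k, Fin (n k) := Pi.single k 1

theorem addOrderOf_cyclicGenerator (k : Fin r) : addOrderOf (cyclicGenerator n k) = n k := by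
  rw [← Fin.addOrderOf_one (n k)]
  exact addOrderOf_injective (AddMonoidHom.single (fun k => Fin (n k)) k)
    (Pi.single_injective (M := fun k => Fin (n k)) k) 1

theorem closure_range_cyclicGenerator :
    AddSubgroup.closure (Set.range (cyclicGenerator n)) = ⊤ := by
  rw [eq_top_iff]
  intro x _
  rw [← Finset.univ_sum_single x]
  refine sum_mem fun k _ => ?_
  have : (Pi.single k (x k) : ∀ k, Fin (n k)) = (x k).val • cyclicGenerator n k := by
    have hx : x k = (x k).val • (1 : Fin (n k)) :=
      Fin.ext (by rw [Fin.val_nsmul_one, Nat.mod_eq_of_lt (x k).isLt])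
    conv_lhs => rw [hx]
    exact map_nsmul (AddMonoidHom.single (fun k => Fin (n k)) k) _ _
  rw [this]
  exact nsmul_mem (AddSubgroup.subset_closure (Set.mem_range_self k)) _

variable {n}

theorem cyclicGenerator_apply_self (k : Fin r) : cyclicGenerator n k k = 1 :=
  Pi.single_eq_same _ _

theorem cyclicGenerator_apply_of_ne {i k : Fin r} (h : k ≠ i) : cyclicGenerator n i k = 0 :=
  Pi.single_eq_of_ne h _

theorem cyclicGenerator_injective (hn : ∀ i, 2 ≤ n i) : (cyclicGenerator n).Injective := by
  intro i k h
  by_contra hik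
  apply Fin.one_ne_zero_of_two_le (hn k)
  rw [← cyclicGenerator_apply_self k, ← h]
  exact cyclicGenerator_apply_of_ne (Ne.symm hik)

/-- The kernel of evaluation at `k` contains `T` but not the `k`-th standard generator. -/
theorem closure_ne_top_of_apply_eq_zero (hn : ∀ i, 2 ≤ n i) (k : Fin r)
    {T : Set (∀ k, Fin (n k))} (hT : ∀ x ∈ T, x k = 0) : AddSubgroup.closure T ≠ ⊤ := by
  intro h
  have hle : AddSubgroup.closure T ≤ (Pi.evalAddMonoidHom (fun k => Fin (n k)) k).ker := by
    rw [AddSubgroup.closure_le]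
    exact fun x hx => hT x hx
  have hmem : cyclicGenerator n k ∈ AddSubgroup.closure T := h ▸ AddSubgroup.mem_top _
  have h1 : cyclicGenerator n k k = 0 := hle hmem
  exact Fin.one_ne_zero_of_two_le (hn k) (by rw [← cyclicGenerator_apply_self k, h1])

theorem isMinimalGenerating_range_cyclicGenerator (hn : ∀ i, 2 ≤ n i) :
    IsMinimalGenerating (Set.range (cyclicGenerator n)) := by
  refine ⟨closure_range_cyclicGenerator n, fun T hT => ?_⟩
  obtain ⟨hsub, x, ⟨k, rfl⟩, hk⟩ := Set.ssubset_iff_exists.1 hT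
  refine closure_ne_top_of_apply_eq_zero hn k fun x hx => ?_
  obtain ⟨i, rfl⟩ := hsub hx
  exact cyclicGenerator_apply_of_ne fun h => hk (h ▸ hx)

variable (n) in
/-- The standard generators of the product of the cyclic groups of orders `n k`, together with
their inverses. -/
def cyclicGenerators : Set (∀ k, Fin (n k)) :=
  {x | ∃ k, x = cyclicGenerator n k ∨ x = -cyclicGenerator n k}

theorem isInverseClosedMinimalGenerating_cyclicGenerators (hn : ∀ i, 2 ≤ n i) :
    IsInverseClosedMinimalGenerating (cyclicGenerators n) := by
  have hne : ∀ k, cyclicGenerator n k ≠ 0 := fun k h =>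
    Fin.one_ne_zero_of_two_le (hn k) (by rw [← cyclicGenerator_apply_self k, h, Pi.zero_apply])
  refine ⟨?_, ?_, ?_, fun T hT hneg => ?_⟩
  · rintro ⟨k, h | h⟩
    · exact hne k h.symm
    · exact hne k (neg_eq_zero.1 h.symm)
  · rintro _ ⟨k, rfl | rfl⟩
    · exact ⟨k, Or.inr rfl⟩
    · exact ⟨k, Or.inl (neg_neg _)⟩
  · rw [eq_top_iff, ← closure_range_cyclicGenerator n]
    refine AddSubgroup.closure_mono ?_
    rintro _ ⟨k, rfl⟩
    exact ⟨k, Or.inl rfl⟩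
  · obtain ⟨hsub, x, ⟨k, hx⟩, hk⟩ := Set.ssubset_iff_exists.1 hT
    -- Since `T` is closed under inverses, losing either of ± the `k`-th generator loses both. All
    -- remaining elements then vanish at `k`.
    have h1 : cyclicGenerator n k ∉ T := by
      rcases hx with rfl | rfl
      · exact hk
      · exact fun h => hk (hneg _ h)
    refine closure_ne_top_of_apply_eq_zero hn k fun y hy => ?_
    obtain ⟨i, rfl | rfl⟩ := hsub hy
    · exact cyclicGenerator_apply_of_ne fun h => h1 (h ▸ hy)
    · rw [Pi.neg_apply, neg_eq_zero]
      exact cyclicGenerator_apply_of_ne fun h => h1 (h ▸ neg_neg (cyclicGenerator n i) ▸ hneg _ hy)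

theorem neg_add_eq_cyclicGenerator_iff {u v : ∀ k, Fin (n k)} {i : Fin r} :
    -u + v = cyclicGenerator n i ↔ v i - u i = 1 ∧ ∀ j, j ≠ i → u j = v j := by
  rw [neg_add_eq_sub]
  constructor
  · intro h
    refine ⟨?_, fun j hj => ?_⟩
    · rw [← Pi.sub_apply, h, cyclicGenerator_apply_self]
    · rw [eq_comm, ← sub_eq_zero, ← Pi.sub_apply, h, cyclicGenerator_apply_of_ne hj]
  · rintro ⟨h, h'⟩
    ext1 j
    rcases eq_or_ne j i with rfl | hj
    · rw [Pi.sub_apply, h, cyclicGenerator_apply_self]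
    · rw [Pi.sub_apply, h' j hj, sub_self, cyclicGenerator_apply_of_ne hj]

theorem toroidalMesh_eq_addCayley (hn : ∀ i, 2 ≤ n i) :
    toroidalMesh n = addCayley (cyclicGenerators n) := by
  ext u v
  have hadj : ∀ i, (cycleGraph (n i)).Adj (u i) (v i) ↔ v i - u i = 1 ∨ u i - v i = 1 := fun i => by
    rw [cycleGraph_adj', Fin.val_eq_one_iff (hn i), Fin.val_eq_one_iff (hn i), or_comm]
  have h1 : ∀ u v : ∀ k, Fin (n k), -u + v ∈ cyclicGenerators n ↔
      ∃ i, -u + v = cyclicGenerator n i ∨ -v + u = cyclicGenerator n i := fun u v => by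
    refine exists_congr fun i => or_congr Iff.rfl ?_
    rw [eq_neg_iff_add_eq_zero, add_comm, ← eq_neg_iff_add_eq_zero, neg_add_rev, neg_neg, eq_comm]
  have h2 : -v + u ∈ cyclicGenerators n ↔ -u + v ∈ cyclicGenerators n := by
    rw [h1, h1]
    exact exists_congr fun i => or_comm
  have h3 : (toroidalMesh n).Adj u v ↔ -u + v ∈ cyclicGenerators n := by
    rw [h1]
    refine exists_congr fun i => ?_
    rw [hadj, neg_add_eq_cyclicGenerator_iff, neg_add_eq_cyclicGenerator_iff, or_and_right]
    exact or_congr Iff.rfl (and_congr Iff.rfl (forall₂_congr fun _ _ => eq_comm))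
  rw [addCayley_adj, h2, or_self, ← h3]
  exact ⟨fun h => ⟨h.ne, h⟩, And.right⟩

end Cayley
end RainbowConnection

open RainbowConnection in
theorem mainTheorem1 (r : ℕ) (n : Fin r → ℕ) (hn : ∀ k, 2 ≤ n k) :
    -- the upper bound
    (evenCount n ≤ r / 2 →
      src (toroidalMesh n) ≤
        (⌈((∑ k, (n k : ℚ)) - (evenCount n : ℚ)) / 2⌉₊ : ℕ∞)) ∧
    (r / 2 + 1 ≤ evenCount n → evenCount n ≤ r →
      src (toroidalMesh n) ≤
        (⌈((∑ k, (n k : ℚ)) - (r : ℚ) + (evenCount n : ℚ)) / 2⌉₊ : ℕ∞)) ∧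
    -- it improves the earlier bound, strictly if `r ≥ 2` and some `n_k` is odd
    meshBound n ≤ ∑ k, ⌈(n k : ℚ) / 2⌉₊ ∧
    (2 ≤ r → (∃ k, Odd (n k)) → meshBound n < ∑ k, ⌈(n k : ℚ) / 2⌉₊) ∧
    -- the negative answer: in that case the mesh is a Cayley graph violating the equality
    (2 ≤ r → (∃ k, Odd (n k)) →
      ∃ (A : Type) (_ : AddCommGroup A) (_ : Finite A) (S : Set A) (T : Finset A),
        IsInverseClosedMinimalGenerating S ∧ (T : Set A) ⊆ S ∧
        IsMinimalGenerating (T : Set A) ∧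
        Nonempty (toroidalMesh n ≃g SimpleGraph.addCayley S) ∧
        ¬ (src (SimpleGraph.addCayley S) = rc (SimpleGraph.addCayley S) ∧
          rc (SimpleGraph.addCayley S) =
            ((∑ a ∈ T, ⌈(addOrderOf a : ℚ) / 2⌉₊ : ℕ) : ℕ∞))) := by
  have hNZ : ∀ k, NeZero (n k) := fun k => ⟨by have := hn k; omega⟩
  have hsrc := src_toroidalMesh_le n hn
  refine ⟨fun h => ?_, fun h _ => ?_, meshBound_le n, meshBound_lt n, fun hr hodd => ?_⟩
  · rwa [meshBound, if_pos h] at hsrc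
  · rwa [meshBound, if_neg (by omega)] at hsrc
  · refine ⟨∀ k, Fin (n k), inferInstance, inferInstance, cyclicGenerators n,
      Finset.univ.image (cyclicGenerator n),
      isInverseClosedMinimalGenerating_cyclicGenerators hn, ?_, ?_, ?_, ?_⟩
    · intro x hx
      obtain ⟨k, -, rfl⟩ := Finset.mem_image.1 (Finset.mem_coe.1 hx)
      exact ⟨k, Or.inl rfl⟩
    · rw [Finset.coe_image, Finset.coe_univ, Set.image_univ]
      exact isMinimalGenerating_range_cyclicGenerator hn
    · rw [toroidalMesh_eq_addCayley hn]
      exact ⟨SimpleGraph.Iso.refl⟩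
    -- The two equalities together would give `src` the value ∑ ⌈n_k/2⌉, which is above the bound
    -- just proved.
    · rintro ⟨h1, h2⟩
      rw [Finset.sum_image fun i _ j _ h => cyclicGenerator_injective hn h] at h2
      simp only [addOrderOf_cyclicGenerator] at h2
      rw [← toroidalMesh_eq_addCayley hn] at h1 h2
      rw [h1, h2, Nat.cast_le] at hsrc
      exact (meshBound_lt n hr hodd).not_ge hsrc
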